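/- Let $(W,S)$ be a Coxeter system with $S$ finite and length function $l$, and let $\Gamma$ be a group of automorphisms of $W$ such that $\gamma(S)=S$ for all $\gamma\in\Gamma$. Let $W^\Gamma=\{w\in W\mid \gamma(w)=w \text{ for all }\gamma\in\Gamma\}$. For $I\subseteq S$ let $W_I=\langle I\rangle$ and, if $W_I$ is finite, let $w_I$ be its longest element, i.e. the unique element of $W_I$ on which $l$ is maximal. Let $\bar S$ be the set of those $\Gamma$-orbits $I$ on $S$ for which $W_I$ is finite. Then $w_I\in W^\Gamma$ for all $I\in\bar S$, the elements $w_I$ $(I\in\bar S)$ are pairwise distinct, and $(W^\Gamma,\{w_I\mid I\in\bar S\})$ is a Coxeter system. Moreover, if $l_\Gamma$ denotes the length function of this Coxeter system, then for all $w,w'\in W^\Gamma$ we have $$l(ww')=l(w)+l(w')\iff l_\Gamma(ww')=l_\Gamma(w)+l_\Gamma(w').$$ In particular, the restriction of $l$ to $W^\Gamma$ is a weight function in the sense of Lusztig on $(W^\Gamma,\{w_I\mid I\in\bar S\})$, that is, an integer-valued function $L$ such that $L(ww')=L(w)+L(w')$ whenever $l_\Gamma(ww')=l_\Gamma(w)+l_\Gamma(w')$.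 -/

import Mathlib

/-- The set `S` of simple reflections of a Coxeter system, as a subset of `W`. -/
def simpleSet {B : Type*} {W : Type*} [Group W] {M : CoxeterMatrix B}
    (cs : CoxeterSystem M W) : Set W :=
  Set.range cs.simple

/-- The standard parabolic subgroup `W_I` of `W`, generated by a set `I` (of simple reflections). -/
def parabolic {W : Type*} [Group W] (I : Set W) : Subgroup W :=
  Subgroup.closure I

/-- `w` is the longest element `w_I` of the parabolic subgroup `W_I`: it lies in `W_I`, and it is
strictly longer than every other element of `W_I`. -/
def IsLongestElement {B : Type*} {W : Type*} [Group W] {M : CoxeterMatrix B}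
    (cs : CoxeterSystem M W) (I : Set W) (w : W) : Prop :=
  w ∈ parabolic I ∧ ∀ u ∈ parabolic I, u ≠ w → cs.length u < cs.length w

/-- The set of those `Γ`-orbits `I` on the set of simple reflections for which `W_I` is finite. -/
def finiteOrbits {B : Type*} {W : Type*} [Group W] {M : CoxeterMatrix B}
    (cs : CoxeterSystem M W) (Γ : Subgroup (MulAut W)) : Set (Set W) :=
  {I | (∃ s ∈ simpleSet cs, I = MulAction.orbit Γ s) ∧ Finite (parabolic I)}

/-- Lusztig's notion of a weight function on a Coxeter group `(W, S)`: an integer-valued function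
that is additive on products `w w'` satisfying `l(ww') = l(w) + l(w')`. -/
def IsWeightFunction {B : Type*} {W : Type*} [Group W] {M : CoxeterMatrix B}
    (cs : CoxeterSystem M W) (L : W → ℤ) : Prop :=
  ∀ w w' : W, cs.length (w * w') = cs.length w + cs.length w' → L (w * w') = L w + L w'

/-!
# Fixed points of diagram automorphisms of Coxeter groups

Let `P I`, for a finite orbit `I`, be the set of fixed elements without right descents in `I`.
The right descent set of a fixed element `w` is `Γ`-stable, so it contains each orbit `I` that it
meets; in that case `w` is longest in `w W_I`, so `W_I` is finite and `w = v w_I` with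
`l(w) = l(v) + l(w_I)`. Hence the elements `w_I` generate the group of fixed points, and `1` and
`w_I` are the only fixed elements of `W_I`.

The exchange condition for fixed elements says that `w_J w = w w_I` whenever `w ∈ P I` and
`w_J w ∉ P I` (`longest_mul_eq_mul_longest`). Indeed each `s ∈ I` is a right descent of `w_J w` but
not of `w`, so the exchange condition of `W` removes a letter from a word for `w_J`; therefore
`w s w⁻¹ ∈ W_J`. It follows that `w w_I w⁻¹` is a fixed element of `W_J` other than `1`, which is
`w_J`.

Such sets `P I` force a Coxeter presentation (`exists_coxeterSystem_of_ascentSets`). Let `f` be the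
map to the fixed points from the Coxeter group with the orders of the products `w_I w_J` as its
matrix. Elements of that Coxeter group without right descent at `I` are mapped into `P I`: by
splitting along cosets of dihedral parabolic subgroups this is reduced to alternating words, where
a violation of the exchange condition contradicts the order of `w_I w_J`. As `1 ∈ P I` and
multiplication by `w_I` leads out of `P I`, the map `f` is injective, and `P I` is the set of
elements without right descent at `I`.

Thus `l` is additive on ascents `w < w w_I` of the new Coxeter system, and this determines the pairs
on which it is additive (`length_mul_eq_iff_of_subadditive`).

The exchange condition of `W` comes from an action of `W` on `W × ZMod 2` that records the parity of
the number of occurrences of an element in the right inversion sequence of a word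
(`CoxeterSystem.inversionAction`).
-/

/-! ### The exchange condition -/

theorem Function.End.one_apply {α : Type*} (a : α) : (1 : Function.End α) a = a := rfl

theorem Function.End.mul_apply {α : Type*} (f g : Function.End α) (a : α) :
    (f * g) a = f (g a) := rfl

namespace CoxeterSystem

variable {B W : Type*} [Group W] {M : CoxeterMatrix B} (cs : CoxeterSystem M W)

open Classical in
/-- The generator `(t, z) ↦ (sᵢ t sᵢ, z + [t = sᵢ])` of the action of `W` on `W × ZMod 2` that
records, in the second coordinate, the parity of the number of occurrences of `t` in the right
inversion sequence of a word. -/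
noncomputable def inversionStep (i : B) : Function.End (W × ZMod 2) := fun p =>
  (cs.simple i * p.1 * cs.simple i, p.2 + if p.1 = cs.simple i then 1 else 0)

/-- The right inversion sequence of the word `(i j)ᵏ` consists of the elements `sⱼ (sᵢ sⱼ)ˡ` with
`l < 2 k`; they are counted here with multiplicity. -/
theorem inversionStep_mul_pow_apply [DecidableEq W] (i j : B) (k : ℕ) (p : W × ZMod 2) :
    ((cs.inversionStep i * cs.inversionStep j) ^ k) p =
      ((cs.simple i * cs.simple j) ^ k * p.1 * ((cs.simple i * cs.simple j) ^ k)⁻¹,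
        p.2 + ∑ l ∈ Finset.range (2 * k),
          if p.1 = cs.simple j * (cs.simple i * cs.simple j) ^ l then 1 else 0) := by
  induction k with
  | zero => simp [Function.End.one_apply]
  | succ k ih =>
    have hcomm : (cs.simple i * cs.simple j) ^ k * cs.simple j =
        cs.simple j * ((cs.simple i * cs.simple j) ^ k)⁻¹ := by
      rw [← inv_pow, mul_inv_rev, cs.inv_simple, cs.inv_simple]
      have h : SemiconjBy (cs.simple j) (cs.simple j * cs.simple i)
          (cs.simple i * cs.simple j) := by
        simp [SemiconjBy, mul_assoc]
      exact (h.pow_right k).eq.symm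
    have hcomm' : ((cs.simple i * cs.simple j) ^ k)⁻¹ * cs.simple j =
        cs.simple j * (cs.simple i * cs.simple j) ^ k := by
      rw [inv_mul_eq_iff_eq_mul, ← mul_assoc, hcomm, inv_mul_cancel_right]
    rw [pow_succ', Function.End.mul_apply, ih]
    have h1 : (cs.simple i * cs.simple j) ^ k * p.1 * ((cs.simple i * cs.simple j) ^ k)⁻¹ =
        cs.simple j ↔ p.1 = cs.simple j * (cs.simple i * cs.simple j) ^ (2 * k) := by
      rw [mul_inv_eq_iff_eq_mul, two_mul, pow_add, ← mul_assoc (cs.simple j),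
        ← eq_inv_mul_iff_mul_eq, ← mul_assoc]
      rw [hcomm']
    have h2 : cs.simple j * ((cs.simple i * cs.simple j) ^ k * p.1 *
        ((cs.simple i * cs.simple j) ^ k)⁻¹) * cs.simple j =
        cs.simple i ↔ p.1 = cs.simple j * (cs.simple i * cs.simple j) ^ (2 * k + 1) := by
      have e : cs.simple j * (cs.simple i * cs.simple j) ^ (2 * k + 1) =
          ((cs.simple i * cs.simple j) ^ k)⁻¹ * (cs.simple j * cs.simple i * cs.simple j) *
            (cs.simple i * cs.simple j) ^ k := by
        rw [mul_assoc (cs.simple j) (cs.simple i), ← mul_assoc _ (cs.simple j), hcomm',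
          mul_assoc, mul_assoc, ← pow_succ', ← pow_add]
        congr 2; omega
      rw [e]
      generalize (cs.simple i * cs.simple j) ^ k = c
      constructor
      · intro h
        rw [← h]; simp [mul_assoc]
      · intro h
        rw [h]; simp [mul_assoc]
    refine Prod.ext ?_ ?_
    · simp [inversionStep, Function.End.mul_apply, pow_succ', mul_assoc]
    · simp only [inversionStep, Function.End.mul_apply, h1, h2]
      rw [show 2 * (k + 1) = 2 * k + 1 + 1 from rfl, Finset.sum_range_succ,
        Finset.sum_range_succ]
      simp only [add_assoc]

/-- Since `sⱼ (sᵢ sⱼ)ˡ` is periodic in `l` with period `M i j`, it takes every value an even number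
of times for `l < 2 * M i j`. -/
theorem isLiftable_inversionStep : M.IsLiftable cs.inversionStep := by
  classical
  intro i j
  funext p
  rw [cs.inversionStep_mul_pow_apply, two_mul, Finset.sum_range_add]
  simp [pow_add, CharTwo.add_self_eq_zero, Function.End.one_apply]

/-- The action of `W` on `W × ZMod 2` with generators `inversionStep`. -/
noncomputable def inversionAction : W →* Function.End (W × ZMod 2) :=
  cs.lift ⟨cs.inversionStep, cs.isLiftable_inversionStep⟩

/-- The parity of the number of occurrences of an element in the right inversion sequence of a
word depends only on the product of the word. -/
theorem inversionAction_wordProd [DecidableEq W] (ω : List B) (p : W × ZMod 2) :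
    cs.inversionAction (cs.wordProd ω) p =
      (cs.wordProd ω * p.1 * (cs.wordProd ω)⁻¹, p.2 + (cs.rightInvSeq ω).count p.1) := by
  induction ω with
  | nil => simp [Function.End.one_apply]
  | cons i ω ih =>
    rw [wordProd_cons, map_mul, Function.End.mul_apply, ih]
    have h : cs.wordProd ω * p.1 * (cs.wordProd ω)⁻¹ = cs.simple i ↔
        (cs.wordProd ω)⁻¹ * cs.simple i * cs.wordProd ω = p.1 := by
      constructor <;> intro h <;> simp [← h, mul_assoc]
    rw [inversionAction, lift_apply_simple]
    refine Prod.ext ?_ ?_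
    · simp [inversionStep, mul_assoc]
    · simp only [inversionStep, h, rightInvSeq, List.count_cons, beq_iff_eq, add_assoc]
      push_cast
      congr

/-- The exchange condition: a right descent of `w` occurs in the right inversion sequence of every
word for `w`. The parity of the number of its occurrences does not depend on the word, and it is
seen to be odd by comparison with a reduced word for `w sᵢ`. -/
theorem simple_mem_rightInvSeq {ω : List B} {i : B} (h : cs.IsRightDescent (cs.wordProd ω) i) :
    cs.simple i ∈ cs.rightInvSeq ω := by
  classical
  obtain ⟨ω', hω', hw⟩ := cs.exists_isReduced (cs.wordProd ω * cs.simple i)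
  have hnot : cs.simple i ∉ cs.rightInvSeq ω' := by
    intro hmem
    have := (cs.isRightInversion_of_mem_rightInvSeq hω' hmem).2
    rw [← hw, simple_mul_simple_cancel_right] at this
    exact lt_asymm this h
  have key : cs.inversionAction (cs.wordProd ω) (cs.simple i, 0) =
      cs.inversionAction (cs.wordProd ω') (cs.simple i, 1) := by
    rw [← hw, map_mul, Function.End.mul_apply]
    rw [inversionAction, lift_apply_simple]
    simp [inversionStep, CharTwo.add_self_eq_zero]
  rw [inversionAction_wordProd, inversionAction_wordProd] at key
  have h2 := congrArg Prod.snd key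
  simp only [List.count_eq_zero_of_not_mem hnot] at h2
  by_contra hcon
  simp [List.count_eq_zero_of_not_mem hcon] at h2

theorem exists_eraseIdx_of_isRightDescent {ω : List B} {i : B}
    (h : cs.IsRightDescent (cs.wordProd ω) i) :
    ∃ j < ω.length, cs.wordProd ω * cs.simple i = cs.wordProd (ω.eraseIdx j) := by
  obtain ⟨j, hj, hji⟩ := List.mem_iff_getElem.mp (cs.simple_mem_rightInvSeq h)
  refine ⟨j, by simpa using hj, ?_⟩
  rw [← wordProd_mul_getD_rightInvSeq, List.getD_eq_getElem _ 1 hj, hji]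

/-- The exchange condition for a product: the letter is removed from one of the two factors. -/
theorem isRightDescent_or_exists_eraseIdx (ω : List B) {y : W} {i : B}
    (h : cs.IsRightDescent (cs.wordProd ω * y) i) :
    cs.IsRightDescent y i ∨ ∃ j < ω.length,
      cs.wordProd ω * y * cs.simple i = cs.wordProd (ω.eraseIdx j) * y := by
  obtain ⟨ψ, hψ, rfl⟩ := cs.exists_isReduced y
  rw [← wordProd_append] at h
  obtain ⟨j, hj, hji⟩ := cs.exists_eraseIdx_of_isRightDescent h
  rcases lt_or_ge j ω.length with hlt | hge
  · right
    refine ⟨j, hlt, ?_⟩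
    rw [← wordProd_append, hji, List.eraseIdx_append_of_lt_length hlt, wordProd_append]
  · left
    rw [List.length_append] at hj
    rw [List.eraseIdx_append_of_length_le hge, wordProd_append, wordProd_append, mul_assoc,
      mul_right_inj] at hji
    rw [IsRightDescent, hji, hψ.eq]
    refine (cs.length_wordProd_le _).trans_lt ?_
    rw [List.length_eraseIdx_of_lt (by omega)]
    omega

theorem isRightDescent_or_exists_length_lt {x y : W} {i : B}
    (h : cs.IsRightDescent (x * y) i) :
    cs.IsRightDescent y i ∨ ∃ x', cs.length x' < cs.length x ∧ x * y * cs.simple i = x' * y := by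
  obtain ⟨ω, hω, rfl⟩ := cs.exists_isReduced x
  refine (cs.isRightDescent_or_exists_eraseIdx ω h).imp_right ?_
  rintro ⟨j, hj, h⟩
  refine ⟨_, ?_, h⟩
  rw [hω.eq]
  refine (cs.length_wordProd_le _).trans_lt ?_
  rw [List.length_eraseIdx_of_lt hj]
  omega

end CoxeterSystem

/-! ### Parabolic subgroups, cosets and longest elements -/

section Parabolic

variable {B W : Type*} [Group W] {M : CoxeterMatrix B} (cs : CoxeterSystem M W)
variable {I : Set W}

theorem wordProd_mem_parabolic {ω : List B} (h : ∀ i ∈ ω, cs.simple i ∈ I) :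
    cs.wordProd ω ∈ parabolic I := by
  induction ω with
  | nil => simp
  | cons i ω ih =>
    rw [cs.wordProd_cons]
    exact mul_mem (Subgroup.subset_closure (h i (by simp)))
      (ih fun j hj => h j (List.mem_cons_of_mem _ hj))

/-- Every element of `W_I` has a reduced word with letters in `I`. -/
theorem exists_isReduced_of_mem_parabolic (hI : I ⊆ simpleSet cs) {u : W}
    (hu : u ∈ parabolic I) :
    ∃ ω : List B, cs.IsReduced ω ∧ (∀ i ∈ ω, cs.simple i ∈ I) ∧ u = cs.wordProd ω := by
  have step : ∀ x s, s ∈ I →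
      (∃ ω : List B, cs.IsReduced ω ∧ (∀ i ∈ ω, cs.simple i ∈ I) ∧ x = cs.wordProd ω) →
      ∃ ω : List B, cs.IsReduced ω ∧ (∀ i ∈ ω, cs.simple i ∈ I) ∧ x * s = cs.wordProd ω := by
    rintro x s hs ⟨ω, hω, hωI, rfl⟩
    obtain ⟨i, rfl⟩ := hI hs
    by_cases hd : cs.IsRightDescent (cs.wordProd ω) i
    · obtain ⟨j, hj, he⟩ := cs.exists_eraseIdx_of_isRightDescent hd
      refine ⟨ω.eraseIdx j, ?_, fun k hk => hωI k (List.mem_of_mem_eraseIdx hk), he⟩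
      rw [CoxeterSystem.IsReduced, ← he, List.length_eraseIdx_of_lt hj]
      have := cs.isRightDescent_iff.1 hd
      rw [hω.eq] at this
      omega
    · refine ⟨ω ++ [i], ?_, ?_, by simp [cs.wordProd_append]⟩
      · rw [CoxeterSystem.IsReduced, cs.wordProd_append, cs.wordProd_singleton,
          cs.not_isRightDescent_iff.1 hd, hω.eq]
        simp
      · intro k hk
        rcases List.mem_append.1 hk with hk | hk
        · exact hωI k hk
        · rw [List.mem_singleton.1 hk]; exact hs
  induction hu using Subgroup.closure_induction_right with
  | one => exact ⟨[], by simp [CoxeterSystem.IsReduced], by simp, by simp⟩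
  | mul_right x _ s hs ih => exact step x s hs ih
  | mul_inv_cancel x _ s hs ih =>
    have : s⁻¹ = s := by obtain ⟨i, rfl⟩ := hI hs; simp
    rw [this]
    exact step x s hs ih

theorem parabolic_induction_right (hI : I ⊆ simpleSet cs) {p : W → Prop} (one : p 1)
    (mul : ∀ u ∈ parabolic I, ∀ s ∈ I, cs.length (u * s) = cs.length u + 1 → p u → p (u * s))
    {u : W} (hu : u ∈ parabolic I) : p u := by
  obtain ⟨ω, hω, hωI, rfl⟩ := exists_isReduced_of_mem_parabolic cs hI hu
  clear hu
  induction ω using List.reverseRecOn with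
  | nil => simpa using one
  | append_singleton ω i ih =>
    have hω' : cs.IsReduced ω := by simpa using hω.take ω.length
    rw [cs.wordProd_append, cs.wordProd_singleton]
    refine mul _ (wordProd_mem_parabolic cs fun j hj => hωI j (by simp [hj])) _
      (hωI i (by simp)) ?_ (ih hω' fun j hj => hωI j (by simp [hj]))
    rw [hω'.eq, ← cs.wordProd_singleton, ← cs.wordProd_append, hω.eq]
    simp

theorem exists_length_mul_lt (hI : I ⊆ simpleSet cs) {u : W} (hu : u ∈ parabolic I)
    (hu1 : u ≠ 1) : ∃ s ∈ I, cs.length (u * s) < cs.length u := by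
  revert hu1
  refine parabolic_induction_right cs hI
    (p := fun u => u ≠ 1 → ∃ s ∈ I, cs.length (u * s) < cs.length u) (by simp) ?_ hu
  intro u _ s hs hl _ _
  refine ⟨s, hs, ?_⟩
  obtain ⟨i, rfl⟩ := hI hs
  rw [hl, cs.simple_mul_simple_cancel_right]
  omega

/-- If all of `I` consists of right descents of `w`, then lengths are subtracted along the coset
`w W_I`; in other words `w` is longest in its coset. -/
theorem length_mul_add_of_forall_lt (hI : I ⊆ simpleSet cs) {w : W}
    (hw : ∀ s ∈ I, cs.length (w * s) < cs.length w) {u : W} (hu : u ∈ parabolic I) :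
    cs.length (w * u) + cs.length u = cs.length w := by
  suffices h : ∀ u ∈ parabolic I, cs.length (w * u⁻¹) + cs.length u = cs.length w by
    simpa using h u⁻¹ (inv_mem hu)
  intro u hu
  refine parabolic_induction_right cs hI
    (p := fun u => cs.length (w * u⁻¹) + cs.length u = cs.length w) (by simp) ?_ hu
  intro u _ s hs hl ih
  have hlt := hw s hs
  obtain ⟨i, rfl⟩ := hI hs
  have hdesc : cs.IsRightDescent (w * u⁻¹ * u) i := by simpa [CoxeterSystem.IsRightDescent]
  rcases cs.isRightDescent_or_exists_length_lt hdesc with h | ⟨x, hx, hxe⟩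
  · rw [CoxeterSystem.IsRightDescent] at h
    omega
  · have hx' : x = w * (u * cs.simple i)⁻¹ := by
      rw [← mul_inv_eq_iff_eq_mul] at hxe
      rw [← hxe]
      simp [mul_assoc]
    subst hx'
    have := cs.length_le_length_mul_add_right w (u * cs.simple i)⁻¹
    rw [cs.length_inv] at this
    omega

/-- If `v` is shortest in its coset `v W_I`, then lengths add up along this coset. -/
theorem length_mul_of_forall_le (hI : I ⊆ simpleSet cs) {v : W}
    (hv : ∀ u ∈ parabolic I, cs.length v ≤ cs.length (v * u)) {u : W} (hu : u ∈ parabolic I) :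
    cs.length (v * u) = cs.length v + cs.length u := by
  refine parabolic_induction_right cs hI
    (p := fun u => cs.length (v * u) = cs.length v + cs.length u) (by simp) ?_ hu
  intro u hu s hs hl ih
  have hsI : s ∈ parabolic I := Subgroup.subset_closure hs
  obtain ⟨i, rfl⟩ := hI hs
  by_cases hd : cs.IsRightDescent (v * u) i
  · exfalso
    rcases cs.isRightDescent_or_exists_length_lt hd with h | ⟨x, hx, hxe⟩
    · rw [CoxeterSystem.IsRightDescent] at h
      omega
    · have hx' : x = v * (u * cs.simple i * u⁻¹) := by
        rw [← mul_inv_eq_iff_eq_mul] at hxe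
        rw [← hxe]
        simp [mul_assoc]
      have := hv _ (mul_mem (mul_mem hu hsI) (inv_mem hu))
      rw [← hx'] at this
      omega
  · rw [← mul_assoc, cs.not_isRightDescent_iff.1 hd, ih, hl]
    omega

/-- Every coset of `W_I` has an element `v` along which lengths add up: one of minimal length. -/
theorem exists_eq_mul_mem_parabolic (hI : I ⊆ simpleSet cs) (w : W) :
    ∃ v, ∃ u ∈ parabolic I, w = v * u ∧
      ∀ u' ∈ parabolic I, cs.length (v * u') = cs.length v + cs.length u' := by
  obtain ⟨v, hv, hmin⟩ := WellFounded.has_min (measure cs.length).wf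
    {v | v⁻¹ * w ∈ parabolic I} ⟨w, by simp⟩
  refine ⟨v, v⁻¹ * w, hv, by simp, fun u' hu' => length_mul_of_forall_le cs hI ?_ hu'⟩
  intro u hu
  refine not_lt.1 (hmin (v * u) ?_)
  simpa [mul_assoc] using mul_mem (inv_mem hu) hv

/-- If `w` has no right descents in `I`, then lengths add up along the coset `w W_I`. -/
theorem length_mul_of_forall_lt (hI : I ⊆ simpleSet cs) {w : W}
    (hw : ∀ s ∈ I, cs.length w < cs.length (w * s)) {u : W} (hu : u ∈ parabolic I) :
    cs.length (w * u) = cs.length w + cs.length u := by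
  obtain ⟨v, x, hx, rfl, hv⟩ := exists_eq_mul_mem_parabolic cs hI w
  by_cases hx1 : x = 1
  · subst hx1
    simpa using hv u hu
  · obtain ⟨s, hs, hlt⟩ := exists_length_mul_lt cs hI hx hx1
    have := hw s hs
    rw [mul_assoc, hv x hx, hv _ (mul_mem hx (Subgroup.subset_closure hs))] at this
    omega

/-- The length of `w` bounds all lengths in `W_I`, so that `W_I` is finite. -/
theorem finite_parabolic_of_forall_lt [Finite B] (hI : I ⊆ simpleSet cs) {w : W}
    (hw : ∀ s ∈ I, cs.length (w * s) < cs.length w) : Finite (parabolic I) := by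
  refine Set.Finite.subset ((List.finite_length_le B (cs.length w)).image cs.wordProd) ?_
  intro u hu
  obtain ⟨ω, hω, rfl⟩ := cs.exists_isReduced u
  refine ⟨ω, ?_, rfl⟩
  have := length_mul_add_of_forall_lt cs hI hw hu
  rw [hω.eq] at this
  exact show ω.length ≤ cs.length w by omega

/-- The right descents of an element of `W_I` belong to `I`. -/
theorem mem_of_length_mul_lt (hI : I ⊆ simpleSet cs) {u s : W} (hu : u ∈ parabolic I)
    (hs : s ∈ simpleSet cs) (h : cs.length (u * s) < cs.length u) : s ∈ I := by
  obtain ⟨ω, hω, hωI, rfl⟩ := exists_isReduced_of_mem_parabolic cs hI hu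
  obtain ⟨i, rfl⟩ := hs
  obtain ⟨j, hj, he⟩ := cs.exists_eraseIdx_of_isRightDescent h
  have hsI : cs.simple i ∈ parabolic I := by
    have := wordProd_mem_parabolic cs (I := I) (ω := ω.eraseIdx j)
      fun k hk => hωI k (List.mem_of_mem_eraseIdx hk)
    rw [← he] at this
    simpa using mul_mem (inv_mem hu) this
  obtain ⟨t, ht, hlt⟩ := exists_length_mul_lt cs hI hsI
    (fun h => by simpa [h] using cs.length_simple i)
  rw [cs.length_simple, Nat.lt_one_iff, cs.length_eq_zero_iff, mul_eq_one_iff_eq_inv] at hlt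
  obtain ⟨k, rfl⟩ := hI ht
  rwa [hlt, cs.inv_simple]

namespace IsLongestElement

variable {cs} {w₀ : W}

theorem length_mul_simple_lt (hI : I ⊆ simpleSet cs) (h : IsLongestElement cs I w₀) {s : W}
    (hs : s ∈ I) : cs.length (w₀ * s) < cs.length w₀ := by
  refine h.2 _ (mul_mem h.1 (Subgroup.subset_closure hs)) ?_
  obtain ⟨i, rfl⟩ := hI hs
  intro he
  simpa [mul_eq_left.1 he] using cs.length_simple i

theorem eq_of_forall_lt (hI : I ⊆ simpleSet cs) (h : IsLongestElement cs I w₀) {u : W}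
    (hu : u ∈ parabolic I) (hd : ∀ s ∈ I, cs.length (u * s) < cs.length u) : u = w₀ := by
  by_contra hne
  have := length_mul_add_of_forall_lt cs hI hd h.1
  have := h.2 u hu hne
  omega

theorem mul_self (hI : I ⊆ simpleSet cs) (h : IsLongestElement cs I w₀) : w₀ * w₀ = 1 := by
  rw [← cs.length_eq_zero_iff]
  have := length_mul_add_of_forall_lt cs hI (fun _ => h.length_mul_simple_lt hI) h.1
  omega

theorem inv_eq (hI : I ⊆ simpleSet cs) (h : IsLongestElement cs I w₀) : w₀⁻¹ = w₀ :=
  inv_eq_of_mul_eq_one_left (h.mul_self hI)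

theorem ne_one (hI : I ⊆ simpleSet cs) (h : IsLongestElement cs I w₀) (hne : I.Nonempty) :
    w₀ ≠ 1 := by
  rintro rfl
  obtain ⟨s, hs⟩ := hne
  simpa using h.length_mul_simple_lt hI hs

end IsLongestElement

theorem exists_isLongestElement (hI : I ⊆ simpleSet cs) [Finite (parabolic I)] :
    ∃ w₀, IsLongestElement cs I w₀ := by
  obtain ⟨⟨w, hw⟩, hmax⟩ := Finite.exists_max fun u : parabolic I => cs.length (u : W)
  have hd : ∀ s ∈ I, cs.length (w * s) < cs.length w := by
    intro s hs
    refine lt_of_le_of_ne (hmax ⟨w * s, mul_mem hw (Subgroup.subset_closure hs)⟩) ?_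
    obtain ⟨i, rfl⟩ := hI hs
    exact cs.length_mul_simple_ne w i
  refine ⟨w, hw, fun u hu hne => lt_of_le_of_ne (hmax ⟨u, hu⟩) fun hl => hne ?_⟩
  -- Elements of maximal length, in particular `w` itself, are inverse to `w`.
  have key : ∀ v ∈ parabolic I, cs.length v = cs.length w → w * v = 1 := by
    intro v hv hl
    have := length_mul_add_of_forall_lt cs hI hd hv
    rw [← cs.length_eq_zero_iff]
    omega
  exact mul_left_cancel ((key u hu hl).trans (key w hw rfl).symm)

end Parabolic

/-! ### Recognizing Coxeter systems -/

section Criterion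

open CoxeterSystem

variable {J G : Type*} [Group G]

theorem CoxeterSystem.length_map {H : Type*} [Group H] {M : CoxeterMatrix J}
    (cs : CoxeterSystem M G) (e : G ≃* H) (g : G) : (cs.map e).length (e g) = cs.length g := by
  have hprod : ∀ ω, (cs.map e).wordProd ω = e (cs.wordProd ω) := fun ω => by
    simp only [wordProd, map_list_prod, List.map_map]
    rfl
  apply le_antisymm
  · obtain ⟨ω, hω, rfl⟩ := cs.exists_isReduced g
    rw [hω.eq, ← hprod]
    exact (cs.map e).length_wordProd_le ω
  · obtain ⟨ω, hω, he⟩ := (cs.map e).exists_isReduced (e g)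
    rw [he, hω.eq, e.injective (he.trans (hprod ω))]
    exact cs.length_wordProd_le ω

/-- The Coxeter matrix of the orders of the products of a family of distinct involutions. Both
`orderOf` and Coxeter matrices encode an infinite order by `0`. -/
noncomputable def orderMatrix (r : J → G) (hr : ∀ i, r i * r i = 1) (hinj : Function.Injective r) :
    CoxeterMatrix J where
  M := Matrix.of fun i j => orderOf (r i * r j)
  isSymm := by
    ext i j
    simp only [Matrix.transpose_apply, Matrix.of_apply]
    rw [← orderOf_inv, mul_inv_rev, inv_eq_of_mul_eq_one_left (hr i),
      inv_eq_of_mul_eq_one_left (hr j)]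
  diagonal i := by simp [hr]
  off_diagonal i j hij h := by
    simp only [Matrix.of_apply, orderOf_eq_one_iff] at h
    exact hij (hinj (mul_right_cancel (h.trans (hr j).symm)))

/-- In a dihedral parabolic subgroup, an element for which `i` is not a right descent is
represented by a reduced alternating word that ends in `j`. -/
theorem exists_eq_wordProd_alternatingWord {M : CoxeterMatrix J} (cs : CoxeterSystem M G) (n : ℕ)
    (i j : J) (u : G) (hu : u ∈ parabolic {cs.simple i, cs.simple j}) (hn : cs.length u = n)
    (hi : ¬ cs.IsRightDescent u i) : u = cs.wordProd (alternatingWord i j n) := by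
  induction n generalizing i j u with
  | zero => simpa [alternatingWord] using hn
  | succ n ih =>
    have hsub : ({cs.simple i, cs.simple j} : Set G) ⊆ simpleSet cs := by
      rintro _ (rfl | rfl) <;> exact ⟨_, rfl⟩
    obtain ⟨s, hs, hlt⟩ := exists_length_mul_lt cs hsub hu (by rintro rfl; simp at hn)
    rcases hs with rfl | rfl
    · exact absurd hlt hi
    · have hj : cs.simple j ∈ parabolic {cs.simple i, cs.simple j} :=
        Subgroup.subset_closure (Or.inr rfl)
      have := ih j i (u * cs.simple j) (by rw [Set.pair_comm]; exact mul_mem hu hj)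
        (by have := cs.isRightDescent_iff.1 hlt; omega)
        (cs.isRightDescent_iff_not_isRightDescent_mul.1 hlt)
      rw [alternatingWord_succ, wordProd_concat, ← this, cs.simple_mul_simple_cancel_right]

/-- A reduced alternating word without right descent at its other letter is shorter than the braid
word. -/
theorem lt_of_not_isRightDescent_alternatingWord {M : CoxeterMatrix J} (cs : CoxeterSystem M G)
    {n : ℕ} {i j : J} (hn : cs.IsReduced (alternatingWord i j n))
    (hi : ¬ cs.IsRightDescent (cs.wordProd (alternatingWord i j n)) i) (hM : M i j ≠ 0) :
    n < M i j := by
  by_contra! hle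
  rcases hle.lt_or_eq with h | h
  · exact cs.not_isReduced_alternatingWord i j hM h hn
  · apply hi
    obtain ⟨m, hm⟩ := Nat.exists_eq_succ_of_ne_zero hM
    have hb : cs.wordProd (alternatingWord i j n) = cs.wordProd (alternatingWord j i n) := by
      have := cs.wordProd_braidWord_eq i j
      rwa [braidWord, braidWord, M.symmetric j i, h] at this
    rw [CoxeterSystem.IsRightDescent, hn.eq, hb]
    rw [length_alternatingWord, ← h, hm, Nat.succ_eq_add_one, alternatingWord_succ,
      wordProd_concat, cs.simple_mul_simple_cancel_right]
    exact (cs.length_wordProd_le _).trans_lt (by simp)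

/-- If the two alternating words of length `n` in two involutions have the same image, then the
order of their product divides `n`. -/
theorem mul_pow_eq_one_of_wordProd_alternatingWord_eq {H : Type*} [Group H] {M : CoxeterMatrix J}
    (cs : CoxeterSystem M G) (f : G →* H) {i j : J} {n : ℕ}
    (h : f (cs.wordProd (alternatingWord i j n)) = f (cs.wordProd (alternatingWord j i n))) :
    (f (cs.simple i) * f (cs.simple j)) ^ n = 1 := by
  rw [prod_alternatingWord_eq_mul_pow, prod_alternatingWord_eq_mul_pow] at h
  have hinv : f (cs.simple j) * f (cs.simple i) = (f (cs.simple i) * f (cs.simple j))⁻¹ := by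
    simp [← map_mul, ← map_inv]
  rcases Nat.even_or_odd' n with ⟨k, rfl | rfl⟩
  · simp only [even_two, Even.mul_right, if_true, one_mul, map_pow, map_mul, hinv, inv_pow,
      Nat.mul_div_cancel_left k two_pos] at h
    rw [eq_inv_iff_mul_eq_one] at h
    rw [two_mul, pow_add, h]
  · have h2 : (2 * k + 1) / 2 = k := by omega
    simp only [Nat.not_even_bit1, if_false, map_mul, map_pow, hinv, inv_pow, h2] at h
    have hii : f (cs.simple i) * f (cs.simple i) = 1 := by simp [← map_mul]
    have h' := congrArg (f (cs.simple i) * ·) h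
    simp only [← mul_assoc, hii, one_mul] at h'
    rw [eq_inv_iff_mul_eq_one] at h'
    rw [show 2 * k + 1 = (1 + k) + k by ring, pow_add, pow_add, pow_one]
    exact h'

/-- A criterion for a group `G` generated by distinct involutions `r i` to be a Coxeter group: it
suffices to have sets `P i` which behave like the sets of elements without right descent at `i`.
The hypothesis `exch` is the exchange condition for `P`, and `mul_mem` is compatibility
with multiplication by the subgroups generated by two of the involutions. -/
theorem exists_coxeterSystem_of_ascentSets (r : J → G) (hr : ∀ i, r i * r i = 1)
    (hinj : Function.Injective r) (hgen : Subgroup.closure (Set.range r) = ⊤) (P : J → Set G)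
    (one_mem : ∀ i, 1 ∈ P i) (mul_notMem : ∀ i, ∀ w ∈ P i, w * r i ∉ P i)
    (exch : ∀ i j, ∀ w ∈ P i, r j * w ∉ P i → r j * w = w * r i)
    (mul_mem : ∀ i j, ∀ v ∈ P i, v ∈ P j → ∀ u ∈ Subgroup.closure {r i, r j}, u ∈ P i →
      v * u ∈ P i) :
    ∃ (M : CoxeterMatrix J) (cs : CoxeterSystem M G), cs.simple = r ∧
      ∀ w i, w ∈ P i ↔ ¬ cs.IsRightDescent w i := by
  let M := orderMatrix r hr hinj
  let cs₀ := M.toCoxeterSystem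
  have hlift : M.IsLiftable r := fun i j => pow_orderOf_eq_one (r i * r j)
  let f : M.Group →* G := cs₀.lift ⟨r, hlift⟩
  have hf : ∀ i, f (cs₀.simple i) = r i := cs₀.lift_apply_simple hlift
  -- Otherwise `exch` would make the two alternating words of some length below the order of
  -- `r i * r j` have the same value.
  have halt : ∀ n i j, (M i j ≠ 0 → n < M i j) →
      f (cs₀.wordProd (alternatingWord i j n)) ∈ P i := by
    intro n
    induction n with
    | zero => intro i j _; simpa [alternatingWord] using one_mem i
    | succ n ih =>
      intro i j hn
      by_contra hcon
      have hsucc := hcon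
      rw [alternatingWord_succ', wordProd_cons, map_mul, hf] at hcon
      have hex := exch i _ _ (ih i j fun h => (hn h).trans' n.lt_succ_self) hcon
      have heq : f (cs₀.wordProd (alternatingWord i j (n + 1))) =
          f (cs₀.wordProd (alternatingWord j i (n + 1))) := by
        rw [alternatingWord_succ', wordProd_cons, map_mul, hf, hex, alternatingWord_succ,
          wordProd_concat, map_mul, hf]
      have hpow := mul_pow_eq_one_of_wordProd_alternatingWord_eq cs₀ f heq
      rw [hf, hf] at hpow
      have hdvd : M i j ∣ n + 1 := orderOf_dvd_of_pow_eq_one hpow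
      by_cases h0 : M i j = 0
      · rw [h0, zero_dvd_iff] at hdvd
        omega
      · exact absurd (Nat.le_of_dvd n.succ_pos hdvd) (not_le.2 (hn h0))
  -- Induction on the length: an element without descent at `i` is split along the dihedral
  -- subgroup generated by `i` and one of its descents `j`.
  have hP : ∀ n g i, cs₀.length g = n → ¬ cs₀.IsRightDescent g i → f g ∈ P i := by
    intro n
    induction n using Nat.strong_induction_on with
    | _ n ih =>
      intro g i hg hi
      by_cases hg1 : g = 1
      · simpa [hg1] using one_mem i
      obtain ⟨j, hj⟩ := cs₀.exists_rightDescent_of_ne_one hg1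
      have hsub : ({cs₀.simple i, cs₀.simple j} : Set M.Group) ⊆ simpleSet cs₀ := by
        rintro _ (rfl | rfl) <;> exact ⟨_, rfl⟩
      obtain ⟨v, u, hu, rfl, hv⟩ := exists_eq_mul_mem_parabolic cs₀ hsub g
      have hmi : cs₀.simple i ∈ parabolic {cs₀.simple i, cs₀.simple j} :=
        Subgroup.subset_closure (Or.inl rfl)
      have hmj : cs₀.simple j ∈ parabolic {cs₀.simple i, cs₀.simple j} :=
        Subgroup.subset_closure (Or.inr rfl)
      have hvi : ¬ cs₀.IsRightDescent v i := by
        rw [IsRightDescent, hv _ hmi]; omega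
      have hvj : ¬ cs₀.IsRightDescent v j := by
        rw [IsRightDescent, hv _ hmj]; omega
      have hu1 : u ≠ 1 := by
        rintro rfl
        rw [mul_one] at hj
        exact hvj hj
      have hpos : 0 < cs₀.length u := Nat.pos_of_ne_zero (mt cs₀.length_eq_zero_iff.1 hu1)
      have hlv : cs₀.length v < n := by
        rw [← hg, hv u hu]; omega
      have hui : ¬ cs₀.IsRightDescent u i := by
        rw [IsRightDescent, mul_assoc, hv u hu, hv _ (Subgroup.mul_mem _ hu hmi)] at hi
        rw [IsRightDescent]
        omega
      have hua := exists_eq_wordProd_alternatingWord cs₀ _ i j u hu rfl hui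
      rw [map_mul]
      refine mul_mem i j _ (ih _ hlv v i rfl hvi) (ih _ hlv v j rfl hvj) _ ?_ ?_
      · have := Subgroup.mem_map_of_mem f hu
        rwa [parabolic, MonoidHom.map_closure, Set.image_pair, hf, hf] at this
      · rw [hua]
        refine halt _ i j (lt_of_not_isRightDescent_alternatingWord cs₀ ?_ ?_)
        · rw [CoxeterSystem.IsReduced, ← hua, length_alternatingWord]
        · rwa [← hua]
  have hfinj : Function.Injective f := by
    rw [injective_iff_map_eq_one]
    intro g hg
    by_contra hg1
    obtain ⟨j, hj⟩ := cs₀.exists_rightDescent_of_ne_one hg1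
    have := mul_notMem j _ (hP _ _ j rfl (cs₀.isRightDescent_iff_not_isRightDescent_mul.1 hj))
    rw [← hf, ← map_mul, cs₀.simple_mul_simple_cancel_right, hg] at this
    exact this (one_mem j)
  have hfsurj : Function.Surjective f := by
    rw [← MonoidHom.range_eq_top, eq_top_iff, ← hgen, Subgroup.closure_le]
    rintro _ ⟨i, rfl⟩
    exact ⟨_, hf i⟩
  let e : M.Group ≃* G := MulEquiv.ofBijective f ⟨hfinj, hfsurj⟩
  have hlen : ∀ g, (cs₀.map e).length (f g) = cs₀.length g := cs₀.length_map e
  refine ⟨M, cs₀.map e, funext hf, fun w i => ?_⟩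
  obtain ⟨g, rfl⟩ := hfsurj w
  have hdesc : (cs₀.map e).IsRightDescent (f g) i ↔ cs₀.IsRightDescent g i := by
    have hs : (cs₀.map e).simple i = f (cs₀.simple i) := rfl
    rw [IsRightDescent, IsRightDescent, hs, ← map_mul, hlen, hlen]
  rw [hdesc]
  refine ⟨fun hw hd => ?_, hP _ g i rfl⟩
  have := mul_notMem i _ (hP _ _ i rfl (cs₀.isRightDescent_iff_not_isRightDescent_mul.1 hd))
  rw [← hf, ← map_mul, cs₀.simple_mul_simple_cancel_right] at this
  exact this hw

/-- A subadditive function on a Coxeter group that is positive on simple reflections and adds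
`L (s i)` at each ascent `w < w (s i)` is additive on exactly the same products as the Coxeter
length. -/
theorem length_mul_eq_iff_of_subadditive {N : CoxeterMatrix J}
    (cs' : CoxeterSystem N G) (L : G → ℕ) (one : L 1 = 0)
    (sub : ∀ v w, L (v * w) ≤ L v + L w) (pos : ∀ i, 0 < L (cs'.simple i))
    (asc : ∀ w i, ¬ cs'.IsRightDescent w i → L (w * cs'.simple i) = L w + L (cs'.simple i))
    (w w' : G) :
    L (w * w') = L w + L w' ↔ cs'.length (w * w') = cs'.length w + cs'.length w' := by
  obtain ⟨ω, hω, rfl⟩ := cs'.exists_isReduced w'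
  induction ω generalizing w with
  | nil => simp [one]
  | cons i ω ih =>
    have hω' : cs'.IsReduced ω := by simpa using hω.drop 1
    have hlen : cs'.length (cs'.simple i * cs'.wordProd ω) = 1 + cs'.length (cs'.wordProd ω) := by
      rw [← cs'.wordProd_cons, hω.eq, hω'.eq, List.length_cons, add_comm]
    have hL : L (cs'.simple i * cs'.wordProd ω) = L (cs'.simple i) + L (cs'.wordProd ω) :=
      (ih (cs'.simple i) hω').2 (by rw [hlen, cs'.length_simple])
    rw [cs'.wordProd_cons, hL, hlen, ← mul_assoc]
    by_cases hd : cs'.IsRightDescent w i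
    · -- both equalities fail, since `w` can be shortened by the letter `i`
      have h1 := asc _ i (cs'.isRightDescent_iff_not_isRightDescent_mul.1 hd)
      rw [cs'.simple_mul_simple_cancel_right] at h1
      have h2 := sub (w * cs'.simple i) (cs'.wordProd ω)
      have h3 := cs'.isRightDescent_iff.1 hd
      have h4 := cs'.length_mul_le (w * cs'.simple i) (cs'.wordProd ω)
      have h5 := pos i
      constructor <;> intro h <;> omega
    · have h1 := ih (w * cs'.simple i) hω'
      rw [asc w i hd, cs'.not_isRightDescent_iff.1 hd] at h1
      rw [← add_assoc, ← add_assoc]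
      exact h1

end Criterion

/-! ### Fixed points of diagram automorphisms -/

section FixedPoints

variable {B W : Type*} [Group W] {M : CoxeterMatrix B} (cs : CoxeterSystem M W)

theorem length_apply_le {γ : MulAut W} (hγ : ∀ s ∈ simpleSet cs, γ s ∈ simpleSet cs) (w : W) :
    cs.length (γ w) ≤ cs.length w := by
  obtain ⟨ω, hω, rfl⟩ := cs.exists_isReduced w
  rw [hω.eq]
  clear hω
  induction ω with
  | nil => simp
  | cons i ω ih =>
    obtain ⟨j, hj⟩ := hγ _ ⟨i, rfl⟩
    rw [cs.wordProd_cons, map_mul, ← hj, List.length_cons]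
    have := cs.length_mul_le (cs.simple j) (γ (cs.wordProd ω))
    rw [cs.length_simple] at this
    omega

variable {cs} {Γ : Subgroup (MulAut W)}

theorem smul_mem_simpleSet (hΓ : ∀ γ ∈ Γ, γ '' simpleSet cs = simpleSet cs) (γ : Γ) {s : W}
    (hs : s ∈ simpleSet cs) : γ • s ∈ simpleSet cs := by
  rw [← hΓ γ γ.2]
  exact ⟨s, hs, rfl⟩

theorem length_smul (hΓ : ∀ γ ∈ Γ, γ '' simpleSet cs = simpleSet cs) (γ : Γ) (w : W) :
    cs.length (γ • w) = cs.length w := by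
  have h : ∀ (γ : Γ) (w : W), cs.length (γ • w) ≤ cs.length w := fun γ w =>
    length_apply_le cs (γ := (γ : MulAut W)) (fun s hs => smul_mem_simpleSet hΓ γ hs) w
  exact (h γ w).antisymm (by simpa using h γ⁻¹ (γ • w))

theorem orbit_subset_simpleSet (hΓ : ∀ γ ∈ Γ, γ '' simpleSet cs = simpleSet cs) {s : W}
    (hs : s ∈ simpleSet cs) : MulAction.orbit Γ s ⊆ simpleSet cs := by
  rintro _ ⟨γ, rfl⟩
  exact smul_mem_simpleSet hΓ γ hs

theorem subset_simpleSet_of_mem_finiteOrbits (hΓ : ∀ γ ∈ Γ, γ '' simpleSet cs = simpleSet cs)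
    {I : Set W} (hI : I ∈ finiteOrbits cs Γ) : I ⊆ simpleSet cs := by
  obtain ⟨⟨s, hs, rfl⟩, -⟩ := hI
  exact orbit_subset_simpleSet hΓ hs

theorem nonempty_of_mem_finiteOrbits {I : Set W} (hI : I ∈ finiteOrbits cs Γ) : I.Nonempty := by
  obtain ⟨⟨s, -, rfl⟩, -⟩ := hI
  exact MulAction.nonempty_orbit s

theorem length_mul_lt_of_mem_orbit (hΓ : ∀ γ ∈ Γ, γ '' simpleSet cs = simpleSet cs) {w : W}
    (hw : w ∈ FixedPoints.subgroup Γ W) {s t : W} (hs : cs.length (w * s) < cs.length w)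
    (ht : t ∈ MulAction.orbit Γ s) : cs.length (w * t) < cs.length w := by
  obtain ⟨γ, rfl⟩ := ht
  have : w * γ • s = γ • (w * s) := by rw [smul_mul', hw γ]
  simpa only [this, length_smul hΓ] using hs

/-- The right descent set of a fixed element is stable under `Γ`, so it contains every orbit that it
meets. -/
theorem forall_length_mul_lt_of_exists (hΓ : ∀ γ ∈ Γ, γ '' simpleSet cs = simpleSet cs) {w : W}
    (hw : w ∈ FixedPoints.subgroup Γ W) {I : Set W} (hI : I ∈ finiteOrbits cs Γ)
    (h : ∃ s ∈ I, cs.length (w * s) < cs.length w) :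
    ∀ t ∈ I, cs.length (w * t) < cs.length w := by
  obtain ⟨⟨r, -, rfl⟩, -⟩ := hI
  obtain ⟨s, hs, hlt⟩ := h
  intro t ht
  refine length_mul_lt_of_mem_orbit hΓ hw hlt ?_
  rwa [MulAction.orbit_eq_iff.2 hs]

theorem smul_mem_parabolic_of_mem_finiteOrbits {I : Set W} (hI : I ∈ finiteOrbits cs Γ) (γ : Γ)
    {u : W} (hu : u ∈ parabolic I) : γ • u ∈ parabolic I := by
  obtain ⟨⟨r, -, rfl⟩, -⟩ := hI
  induction hu using Subgroup.closure_induction with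
  | mem s hs =>
    refine Subgroup.subset_closure ?_
    exact MulAction.mapsTo_smul_orbit γ r hs
  | one => simp
  | mul x y _ _ hx hy => rw [smul_mul']; exact mul_mem hx hy
  | inv x _ hx => rw [smul_inv']; exact inv_mem hx

theorem IsLongestElement.mem_fixedPoints (hΓ : ∀ γ ∈ Γ, γ '' simpleSet cs = simpleSet cs)
    {I : Set W} (hI : I ∈ finiteOrbits cs Γ) {w₀ : W} (h : IsLongestElement cs I w₀) :
    w₀ ∈ FixedPoints.subgroup Γ W := by
  intro γ
  by_contra hne
  have := h.2 _ (smul_mem_parabolic_of_mem_finiteOrbits hI γ h.1) hne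
  rw [length_smul hΓ] at this
  exact lt_irrefl _ this

/-- The only fixed elements of the parabolic subgroup of a finite orbit are `1` and the longest
element. -/
theorem IsLongestElement.eq_of_mem_fixedPoints
    (hΓ : ∀ γ ∈ Γ, γ '' simpleSet cs = simpleSet cs)
    {I : Set W} (hI : I ∈ finiteOrbits cs Γ) {w₀ : W} (h : IsLongestElement cs I w₀) {u : W}
    (hu : u ∈ parabolic I) (hfix : u ∈ FixedPoints.subgroup Γ W) (hu1 : u ≠ 1) : u = w₀ := by
  have hsub := subset_simpleSet_of_mem_finiteOrbits hΓ hI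
  exact h.eq_of_forall_lt hsub hu
    (forall_length_mul_lt_of_exists hΓ hfix hI (exists_length_mul_lt cs hsub hu hu1))

/-- Distinct finite orbits have distinct longest elements: the descents of a common longest element
lie in both orbits. -/
theorem eq_of_isLongestElement (hΓ : ∀ γ ∈ Γ, γ '' simpleSet cs = simpleSet cs)
    {I J : Set W} (hI : I ∈ finiteOrbits cs Γ) (hJ : J ∈ finiteOrbits cs Γ) {w₀ : W}
    (h : IsLongestElement cs I w₀) (h' : IsLongestElement cs J w₀) : I = J := by
  have hIS := subset_simpleSet_of_mem_finiteOrbits hΓ hI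
  have hJS := subset_simpleSet_of_mem_finiteOrbits hΓ hJ
  obtain ⟨s, hs⟩ := nonempty_of_mem_finiteOrbits hI
  have hsJ := mem_of_length_mul_lt cs hJS h'.1 (hIS hs) (h.length_mul_simple_lt hIS hs)
  obtain ⟨⟨r, -, rfl⟩, -⟩ := hI
  obtain ⟨⟨r', -, rfl⟩, -⟩ := hJ
  exact (MulAction.orbit_eq_iff.2 hs).symm.trans (MulAction.orbit_eq_iff.2 hsJ)

/-- The exchange condition in the group of fixed points. -/
theorem longest_mul_eq_mul_longest (hΓ : ∀ γ ∈ Γ, γ '' simpleSet cs = simpleSet cs)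
    {I J : Set W} (hI : I ∈ finiteOrbits cs Γ) (hJ : J ∈ finiteOrbits cs Γ) {wI wJ : W}
    (hwI : IsLongestElement cs I wI) (hwJ : IsLongestElement cs J wJ) {w : W}
    (hfix : w ∈ FixedPoints.subgroup Γ W)
    (hw : ∀ s ∈ I, cs.length w < cs.length (w * s))
    (hlt : ∃ s ∈ I, cs.length (wJ * w * s) < cs.length (wJ * w)) : wJ * w = w * wI := by
  have hIS := subset_simpleSet_of_mem_finiteOrbits hΓ hI
  have hJS := subset_simpleSet_of_mem_finiteOrbits hΓ hJ
  have hfI := hwI.mem_fixedPoints hΓ hI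
  have hfJ := hwJ.mem_fixedPoints hΓ hJ
  -- The exchange condition removes a letter from `wJ`, not from `w`; so `w` conjugates `I` into
  -- `W_J`.
  have hconj : ∀ s ∈ I, w * s * w⁻¹ ∈ parabolic J := by
    intro s hs
    have hd := forall_length_mul_lt_of_exists hΓ (mul_mem hfJ hfix) hI hlt s hs
    have hws := hw s hs
    obtain ⟨i, rfl⟩ := hIS hs
    obtain ⟨ω, -, hωJ, he⟩ := exists_isReduced_of_mem_parabolic cs hJS hwJ.1
    rw [he] at hd
    rcases cs.isRightDescent_or_exists_eraseIdx ω hd with h | ⟨j, -, h⟩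
    · exact absurd h hws.le.not_gt
    · have hm := wordProd_mem_parabolic cs (I := J) (ω := ω.eraseIdx j)
        fun k hk => hωJ k (List.mem_of_mem_eraseIdx hk)
      have : w * cs.simple i * w⁻¹ = wJ⁻¹ * cs.wordProd (ω.eraseIdx j) := by
        rw [← he] at h
        rw [mul_inv_eq_iff_eq_mul, mul_assoc, ← h]
        simp [mul_assoc]
      rw [this]
      exact mul_mem (inv_mem hwJ.1) hm
  have hle : parabolic I ≤ (parabolic J).comap (MulAut.conj w).toMonoidHom := by
    rw [parabolic, Subgroup.closure_le]
    exact hconj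
  have hmem : w * wI * w⁻¹ ∈ parabolic J := hle hwI.1
  have hne : w * wI * w⁻¹ ≠ 1 := by
    rw [Ne, conj_eq_one_iff]
    exact hwI.ne_one hIS (nonempty_of_mem_finiteOrbits hI)
  rw [← hwJ.eq_of_mem_fixedPoints hΓ hJ hmem (mul_mem (mul_mem hfix hfI) (inv_mem hfix)) hne]
  simp

/-- The right descents of a fixed element other than `1` contain a whole orbit `I`, and `W_I` is then
finite. -/
theorem exists_mem_finiteOrbits_forall_lt [Finite B]
    (hΓ : ∀ γ ∈ Γ, γ '' simpleSet cs = simpleSet cs) {w : W}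
    (hfix : w ∈ FixedPoints.subgroup Γ W) (hw : w ≠ 1) :
    ∃ I ∈ finiteOrbits cs Γ, ∀ s ∈ I, cs.length (w * s) < cs.length w := by
  obtain ⟨i, hi⟩ := cs.exists_rightDescent_of_ne_one hw
  have hs : cs.simple i ∈ simpleSet cs := ⟨i, rfl⟩
  have hall : ∀ t ∈ MulAction.orbit Γ (cs.simple i), cs.length (w * t) < cs.length w :=
    fun t ht => length_mul_lt_of_mem_orbit hΓ hfix hi ht
  exact ⟨_, ⟨⟨_, hs, rfl⟩,
    finite_parabolic_of_forall_lt cs (orbit_subset_simpleSet hΓ hs) hall⟩, hall⟩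

theorem closure_longestElements_eq_top [Finite B]
    (hΓ : ∀ γ ∈ Γ, γ '' simpleSet cs = simpleSet cs)
    (r : finiteOrbits cs Γ → FixedPoints.subgroup Γ W)
    (hr : ∀ I : finiteOrbits cs Γ, IsLongestElement cs (I : Set W) (r I : W)) :
    Subgroup.closure (Set.range r) = ⊤ := by
  rw [eq_top_iff]
  suffices h : ∀ n, ∀ w : FixedPoints.subgroup Γ W, cs.length (w : W) = n →
      w ∈ Subgroup.closure (Set.range r) from fun w _ => h _ w rfl
  intro n
  induction n using Nat.strong_induction_on with
  | _ n ih =>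
    intro w hn
    by_cases hw : w = 1
    · rw [hw]; exact one_mem _
    obtain ⟨I, hI, hd⟩ := exists_mem_finiteOrbits_forall_lt hΓ w.2
      (fun h => hw (Subtype.ext h))
    have hIS := subset_simpleSet_of_mem_finiteOrbits hΓ hI
    have hrI := hr ⟨I, hI⟩
    have hlen := length_mul_add_of_forall_lt cs hIS hd hrI.1
    have hpos : cs.length (r ⟨I, hI⟩ : W) ≠ 0 :=
      mt cs.length_eq_zero_iff.1 (hrI.ne_one hIS (nonempty_of_mem_finiteOrbits hI))
    have hmem := ih _ (by rw [Subgroup.coe_mul]; omega) (w * r ⟨I, hI⟩) rfl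
    exact (Subgroup.mul_mem_cancel_right _
      (Subgroup.subset_closure (Set.mem_range_self (⟨I, hI⟩ : finiteOrbits cs Γ)))).1 hmem

end FixedPoints

theorem theorem1 {B : Type*} [Finite B] {W : Type*} [Group W] {M : CoxeterMatrix B}
    (cs : CoxeterSystem M W) (Γ : Subgroup (MulAut W))
    (hΓ : ∀ γ ∈ Γ, γ '' simpleSet cs = simpleSet cs) :
    ∃ (MΓ : CoxeterMatrix (finiteOrbits cs Γ))
      (csΓ : CoxeterSystem MΓ (FixedPoints.subgroup Γ W)),
      (∀ I : finiteOrbits cs Γ,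
        IsLongestElement cs (I : Set W) (csΓ.simple I : W)) ∧
      (∀ w w' : FixedPoints.subgroup Γ W,
        cs.length ((w : W) * (w' : W)) = cs.length (w : W) + cs.length (w' : W) ↔
          csΓ.length (w * w') = csΓ.length w + csΓ.length w') ∧
      IsWeightFunction csΓ (fun w => (cs.length (w : W) : ℤ)) := by
  have hex : ∀ I : finiteOrbits cs Γ, ∃ w : FixedPoints.subgroup Γ W,
      IsLongestElement cs (I : Set W) (w : W) := by
    rintro ⟨I, hI⟩
    have := hI.2
    obtain ⟨w, hw⟩ := exists_isLongestElement cs (subset_simpleSet_of_mem_finiteOrbits hΓ hI)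
    exact ⟨⟨w, hw.mem_fixedPoints hΓ hI⟩, hw⟩
  choose r hr using hex
  have hS : ∀ I : finiteOrbits cs Γ, (I : Set W) ⊆ simpleSet cs := fun I =>
    subset_simpleSet_of_mem_finiteOrbits hΓ I.2
  have hne : ∀ I : finiteOrbits cs Γ, (I : Set W).Nonempty := fun I =>
    nonempty_of_mem_finiteOrbits I.2
  let P : finiteOrbits cs Γ → Set (FixedPoints.subgroup Γ W) := fun I =>
    {w | ∀ s ∈ (I : Set W), cs.length (w : W) < cs.length ((w : W) * s)}
  obtain ⟨MΓ, csΓ, hsimple, hP⟩ := exists_coxeterSystem_of_ascentSets r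
    (fun I => Subtype.ext ((hr I).mul_self (hS I)))
    (fun I J h => Subtype.ext (eq_of_isLongestElement hΓ I.2 J.2 (hr I) (h ▸ hr J)))
    (closure_longestElements_eq_top hΓ r hr) P
    (by
      intro I s hs
      obtain ⟨i, rfl⟩ := hS I hs
      simp)
    (by
      intro I w hw h
      obtain ⟨s, hs⟩ := hne I
      have h1 := h s hs
      have h2 := (hr I).length_mul_simple_lt (hS I) hs
      have h3 := length_mul_of_forall_lt cs (hS I) hw (hr I).1
      have h4 := length_mul_of_forall_lt cs (hS I) hw
        (mul_mem (hr I).1 (Subgroup.subset_closure hs))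
      simp only [Subgroup.coe_mul, mul_assoc] at h1
      omega)
    (by
      intro I J w hw h
      refine Subtype.ext (longest_mul_eq_mul_longest hΓ I.2 J.2 (hr I) (hr J) w.2 hw ?_)
      by_contra! hcon
      refine h fun s hs => lt_of_le_of_ne (hcon s hs) ?_
      obtain ⟨i, rfl⟩ := hS I hs
      exact (cs.length_mul_simple_ne _ i).symm)
    (by
      intro I J v hvI hvJ u hu huI s hs
      have hsub : (I ∪ J : Set W) ⊆ simpleSet cs := Set.union_subset (hS I) (hS J)
      have hv : ∀ s ∈ (I ∪ J : Set W), cs.length (v : W) < cs.length ((v : W) * s) := by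
        rintro s (hs | hs)
        exacts [hvI s hs, hvJ s hs]
      have hmono : ∀ K ⊆ (I ∪ J : Set W), parabolic K ≤ parabolic (I ∪ J : Set W) :=
        fun K hK => Subgroup.closure_mono hK
      have hu' : (u : W) ∈ parabolic (I ∪ J : Set W) := by
        have hle : Subgroup.closure {r I, r J} ≤
            (parabolic (I ∪ J : Set W)).comap (FixedPoints.subgroup Γ W).subtype := by
          rw [Subgroup.closure_le]
          rintro _ (rfl | rfl)
          · exact hmono _ Set.subset_union_left (hr I).1
          · exact hmono _ Set.subset_union_right (hr J).1
        exact hle hu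
      have h1 := length_mul_of_forall_lt cs hsub hv hu'
      have h2 := length_mul_of_forall_lt cs hsub hv
        (mul_mem hu' (Subgroup.subset_closure (Or.inl hs)))
      have h3 := huI s hs
      simp only [Subgroup.coe_mul, mul_assoc]
      omega)
  have hiff := length_mul_eq_iff_of_subadditive csΓ (fun w => cs.length (w : W)) (by simp)
    (fun v w => cs.length_mul_le v w)
    (fun I => Nat.pos_of_ne_zero (by
      rw [hsimple]
      exact mt cs.length_eq_zero_iff.1 ((hr I).ne_one (hS I) (hne I))))
    (fun w I h => by
      rw [hsimple]
      exact length_mul_of_forall_lt cs (hS I) ((hP w I).2 h) (hr I).1)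
  refine ⟨MΓ, csΓ, fun I => hsimple ▸ hr I, hiff, fun w w' h => ?_⟩
  have := (hiff w w').2 h
  simp only
  exact_mod_cast this
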